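/- Let $k$ be an algebraically closed field of characteristic $0$. For a commutative $k$-algebra $B$ and $B$-modules $N, N'$, let $\mathrm{HH}^1(B,\mathrm{Hom}_k(N,N'))$ be the quotient of the space of derivations $\psi : B \to \mathrm{Hom}_k(N,N')$ (that is, $k$-linear maps with $\psi(ab)(n)=a\,\psi(b)(n)+\psi(a)(bn)$) by the trivial derivations $a \mapsto a\chi-\chi a$, $\chi\in\mathrm{Hom}_k(N,N')$. It is identified with $\mathrm{Ext}^1_B(N,N')$ by sending the class of $\psi$ to the class of the extension $0\to N'\to N'\oplus N\to N\to 0$, where $a\in B$ acts on $N' \oplus N$ by $a(n',n)=(an'+\psi(a)(n),an)$. For a $B$-module $N$: * The Kodaira–Spencer map $g:\mathrm{Der}_k(B)\to \mathrm{Ext}^1_B(N,N)$ sends $D$ to the class of the derivation $\psi_D(a)(n)=D(a)n$, and $\mathsf V(N)=\ker(g)\subseteq \mathrm{Der}_k(B)$. It is a $B$-submodule, and it consists of those $D$ for which there is a $k$-linear map $\nabla_D:N\to N$ with $\nabla_D(an)=a\nabla_D(n)+D(a)n$ for all $a\in B$, $n\in N$. * Choose a $k$-linear map $\nabla:\mathsf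 V(N)\to \mathrm{End}_k(N)$ such that $\nabla_D(an)=a\nabla_D(n)+D(a)n$ for all $D\in\mathsf V(N)$, $a\in B$, $n\in N$. Then $\mathsf{lc}(N)\in\mathrm{Ext}^1_B(\mathsf V(N),\mathrm{End}_B(N))$ is the class of the derivation $\phi(a)(D)=a\nabla_D-\nabla_{aD}$. It does not depend on the choice of $\nabla$. **Lemma.** Let $A$ be a commutative $k$-algebra of finite type, let $\mathfrak m\subset A$ be a maximal ideal, and let $M$ be a finitely generated $A$-module such that $M_{\mathfrak p}$ is a free $A_{\mathfrak p}$-module for every prime ideal $\mathfrak p\neq \mathfrak m$ of $A$. Consider $M_{\mathfrak m}$ as a module over the local ring $A_{\mathfrak m}$, and the $\mathfrak m$-adic completion $\widehat M$ as a module over the $\mathfrak m$-adic completion $\widehat A$. Then 1. $\mathsf V(M)=\mathrm{Der}_k(A)\iff \mathsf V(M_{\mathfrak m})=\mathrm{Der}_k(A_{\mathfrak m})\iff \mathsf V(\widehat M)=\mathrm{Der}_k(\widehat A)$; 2. $\mathsf{lc}(M)=0\iff \mathsf{lc}(M_{\mathfrak m})=0\iff \mathsf{lc}(\widehat M)=0$.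 -/

import Mathlib

universe v u

set_option maxSynthPendingDepth 3

namespace KodairaSpencer

open CategoryTheory

noncomputable section

/-! ### First Hochschild cohomology with values in `Hom_k(M, N)` -/

section Hochschild

variable (k : Type v) (A M N : Type u) [Field k] [CommRing A] [Algebra k A]
  [AddCommGroup M] [Module A M] [Module k M] [IsScalarTower k A M]
  [AddCommGroup N] [Module A N] [Module k N] [IsScalarTower k A N]

/-- `Der_k(A, Hom_k(M, N))`, the Hochschild 1-cocycles of `A` with values in the bimodule
`Hom_k(M, N)`, where `(a φ)(m) = a φ(m)` and `(φ a)(m) = φ(a m)`. -/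
def Z1 : Submodule k (A →ₗ[k] M →ₗ[k] N) where
  carrier := {ψ | ∀ (a b : A) (m : M), ψ (a * b) m = a • ψ b m + ψ a (b • m)}
  zero_mem' := by intro a b m; simp
  add_mem' := by
    intro ψ χ hψ hχ a b m
    simp only [LinearMap.add_apply, hψ a b m, hχ a b m, smul_add]
    abel
  smul_mem' := by
    intro c ψ hψ a b m
    simp only [LinearMap.smul_apply, hψ a b m, smul_add, smul_comm c a]

/-- The differential `d⁰ : Hom_k(M, N) → Der_k(A, Hom_k(M, N))`, `d⁰(χ)(a) = a χ - χ a`.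
Its range consists of the trivial derivations. -/
def d0 : (M →ₗ[k] N) →ₗ[k] Z1 k A M N where
  toFun χ :=
    ⟨LinearMap.mk₂ k (fun (a : A) (m : M) => a • χ m - χ (a • m))
      (by intro a b m; simp only [add_smul, map_add]; abel)
      (by intro c a m; simp only [smul_assoc, map_smul, smul_sub])
      (by intro a m n; simp only [smul_add, map_add]; abel)
      (by intro c a m; simp only [smul_comm a c, map_smul, smul_sub]),
     by
      intro a b m
      simp only [LinearMap.mk₂_apply, mul_smul, smul_sub]
      abel⟩
  map_add' χ χ' := by
    ext a m
    simp only [LinearMap.mk₂_apply, LinearMap.add_apply, Submodule.coe_add, smul_add]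
    abel
  map_smul' c χ := by
    ext a m
    simp [smul_sub, smul_comm a c]

@[simp]
theorem d0_apply (χ : M →ₗ[k] N) (a : A) (m : M) :
    (d0 k A M N χ).1 a m = a • χ m - χ (a • m) := rfl

/-- The first Hochschild cohomology `HH¹(A, Hom_k(M, N))`. -/
abbrev HH1 : Type _ := Z1 k A M N ⧸ LinearMap.range (d0 k A M N)

end Hochschild

/-! ### The identification of `HH¹(A, Hom_k(M, N))` with `Ext¹_A(M, N)` -/

section Extension

variable {k : Type v} {A M N : Type u} [Field k] [CommRing A] [Algebra k A]
  [AddCommGroup M] [Module A M] [Module k M] [IsScalarTower k A M]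
  [AddCommGroup N] [Module A N] [Module k N] [IsScalarTower k A N]

/-- The extension of `M` by `N` given by a derivation `ψ : A → Hom_k(M, N)`: the abelian group
`N × M`, on which `a : A` acts as `a (n, m) = (a n + ψ(a)(m), a m)`. -/
def Extension (_ψ : Z1 k A M N) : Type u := N × M

instance (ψ : Z1 k A M N) : AddCommGroup (Extension ψ) :=
  inferInstanceAs (AddCommGroup (N × M))

instance (ψ : Z1 k A M N) : SMul A (Extension ψ) :=
  ⟨fun a x => (a • x.1 + ψ.1 a x.2, a • x.2)⟩

theorem Extension.smul_def (ψ : Z1 k A M N) (a : A) (x : Extension ψ) :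
    a • x = (a • x.1 + ψ.1 a x.2, a • x.2) := rfl

theorem Z1_map_one (ψ : Z1 k A M N) (m : M) : ψ.1 1 m = 0 := by
  have h := ψ.2 1 1 m
  simpa using h

instance (ψ : Z1 k A M N) : Module A (Extension ψ) where
  one_smul x := by
    refine Prod.ext ?_ ?_ <;> simp [Extension.smul_def, Z1_map_one]
  mul_smul a b x := by
    refine Prod.ext ?_ ?_
    · change (a * b) • x.1 + ψ.1 (a * b) x.2 = a • (b • x.1 + ψ.1 b x.2) + ψ.1 a (b • x.2)
      rw [ψ.2 a b, mul_smul, smul_add, add_assoc]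
    · change (a * b) • x.2 = a • b • x.2
      rw [mul_smul]
  smul_zero a := by
    refine Prod.ext ?_ ?_
    · change a • (0 : N) + ψ.1 a (0 : M) = 0
      simp
    · change a • (0 : M) = 0
      simp
  smul_add a x y := by
    refine Prod.ext ?_ ?_
    · change a • (x.1 + y.1) + ψ.1 a (x.2 + y.2) = (a • x.1 + ψ.1 a x.2) + (a • y.1 + ψ.1 a y.2)
      simp only [smul_add, map_add]
      abel
    · change a • (x.2 + y.2) = a • x.2 + a • y.2
      simp
  add_smul a b x := by
    refine Prod.ext ?_ ?_
    · change (a + b) • x.1 + ψ.1 (a + b) x.2 = (a • x.1 + ψ.1 a x.2) + (b • x.1 + ψ.1 b x.2)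
      simp only [add_smul, map_add, LinearMap.add_apply]
      abel
    · change (a + b) • x.2 = a • x.2 + b • x.2
      simp only [add_smul]
  zero_smul x := by
    refine Prod.ext ?_ ?_
    · change (0 : A) • x.1 + ψ.1 0 x.2 = 0
      simp
    · change (0 : A) • x.2 = 0
      simp

/-- The inclusion `N → N ×_ψ M`. -/
def Extension.inl (ψ : Z1 k A M N) : N →ₗ[A] Extension ψ where
  toFun n := (n, (0 : M))
  map_add' x y := by
    refine Prod.ext ?_ ?_
    · rfl
    · change (0 : M) = 0 + 0
      simp
  map_smul' a x := by
    refine Prod.ext ?_ ?_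
    · change a • x = a • x + ψ.1 a (0 : M)
      simp
    · change (0 : M) = a • (0 : M)
      simp

/-- The projection `N ×_ψ M → M`. -/
def Extension.snd (ψ : Z1 k A M N) : Extension ψ →ₗ[A] M where
  toFun x := x.2
  map_add' _ _ := rfl
  map_smul' _ _ := rfl

/-- The sequence `0 → N → N ×_ψ M → M → 0` of `A`-modules. -/
def Extension.shortComplex (ψ : Z1 k A M N) : ShortComplex (ModuleCat.{u} A) :=
  ShortComplex.moduleCatMk (Extension.inl ψ) (Extension.snd ψ) (by ext x; rfl)

theorem Extension.shortExact (ψ : Z1 k A M N) : (Extension.shortComplex ψ).ShortExact where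
  exact := by
    rw [ShortComplex.ShortExact.moduleCat_exact_iff_function_exact]
    intro x
    constructor
    · intro hx
      exact ⟨x.1, Prod.ext rfl (Eq.symm hx)⟩
    · rintro ⟨n, rfl⟩
      rfl
  mono_f := by
    refine (ModuleCat.mono_iff_injective _).2 ?_
    intro x y h
    exact congrArg Prod.fst h
  epi_g := by
    refine (ModuleCat.epi_iff_surjective _).2 ?_
    intro x
    exact ⟨((0 : N), x), rfl⟩

/-- The class in `Ext¹_A(M, N)` of the extension given by `ψ`. -/
def extClass (ψ : Z1 k A M N) :
    Abelian.Ext.{u} (ModuleCat.of A M) (ModuleCat.of A N) 1 :=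
  (Extension.shortExact ψ).extClass

/-- Derivations that differ by a trivial derivation have isomorphic extensions. -/
theorem extClass_eq_of_sub_mem {ψ ψ' : Z1 k A M N}
    (h : ψ - ψ' ∈ LinearMap.range (d0 k A M N)) : extClass ψ = extClass ψ' := by
  obtain ⟨χ, hχ⟩ := h
  have hχ' : ∀ (a : A) (m : M), a • χ m - χ (a • m) = ψ.1 a m - ψ'.1 a m := by
    intro a m
    have := congrArg (fun f : Z1 k A M N => f.1 a m) hχ
    simpa using this
  let F : Extension ψ →ₗ[A] Extension ψ' :=
    { toFun := fun x => (x.1 + χ x.2, x.2)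
      map_add' := by
        intro x y
        refine Prod.ext ?_ rfl
        change x.1 + y.1 + χ (x.2 + y.2) = (x.1 + χ x.2) + (y.1 + χ y.2)
        simp only [map_add]
        abel
      map_smul' := by
        intro a x
        refine Prod.ext ?_ rfl
        change a • x.1 + ψ.1 a x.2 + χ (a • x.2) = a • (x.1 + χ x.2) + ψ'.1 a x.2
        have := hχ' a x.2
        rw [sub_eq_sub_iff_add_eq_add] at this
        rw [smul_add, add_assoc, add_assoc, ← this] }
  let f : Extension.shortComplex ψ ⟶ Extension.shortComplex ψ' :=
    { τ₁ := 𝟙 _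
      τ₂ := ModuleCat.ofHom F
      τ₃ := 𝟙 _
      comm₁₂ := by
        ext n
        refine Prod.ext ?_ rfl
        have h0 : ∀ n' : N, n' = n' + χ (0 : M) := by simp
        exact h0 n
      comm₂₃ := by
        ext x
        rfl }
  have key := ShortComplex.ShortExact.extClass_naturality
    (Extension.shortExact ψ) (Extension.shortExact ψ') f
  change (Extension.shortExact ψ).extClass.comp (Abelian.Ext.mk₀ (𝟙 _)) (add_zero 1) =
    (Abelian.Ext.mk₀ (𝟙 _)).comp (Extension.shortExact ψ').extClass (zero_add 1) at key
  rw [Abelian.Ext.comp_mk₀_id, Abelian.Ext.mk₀_id_comp] at key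
  exact key

/-- The canonical map `HH¹(A, Hom_k(M, N)) → Ext¹_A(M, N)`. -/
def hh1ToExt : HH1 k A M N → Abelian.Ext.{u} (ModuleCat.of A M) (ModuleCat.of A N) 1 :=
  Quotient.lift extClass (by
    intro ψ ψ' h
    exact extClass_eq_of_sub_mem ((Submodule.quotientRel_def _).1 h))

theorem extClass_eq_zero_iff (ψ : Z1 k A M N) :
    extClass ψ = 0 ↔ ψ ∈ LinearMap.range (d0 k A M N) := by
  constructor
  · intro h
    have hS := Extension.shortExact ψ
    obtain ⟨x₂, hx₂⟩ := Abelian.Ext.covariant_sequence_exact₃ (ModuleCat.of A M) hS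
      (Abelian.Ext.mk₀ (𝟙 (ModuleCat.of A M))) (n₁ := 1) (by norm_num) ((Abelian.Ext.mk₀_id_comp _).trans h)
    obtain ⟨s, rfl⟩ := Abelian.Ext.addEquiv₀.symm.surjective x₂
    have hs : s ≫ (Extension.shortComplex ψ).g = 𝟙 (ModuleCat.of A M) := by
      apply Abelian.Ext.addEquiv₀.symm.injective
      have h3 : (Abelian.Ext.mk₀ s).comp (Abelian.Ext.mk₀ (Extension.shortComplex ψ).g)
        (add_zero 0) = Abelian.Ext.mk₀ (𝟙 (ModuleCat.of A M)) := hx₂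
      rw [Abelian.Ext.mk₀_comp_mk₀] at h3
      exact h3
    let t : M →ₗ[A] Extension ψ := s.hom
    have ht : ∀ m, (t m).2 = m := fun m =>
      congrArg (fun f : ModuleCat.of A M ⟶ ModuleCat.of A M => f.hom m) hs
    let χ : M →ₗ[k] N :=
      { toFun := fun m => -(t m).1
        map_add' := by
          intro x y
          have := congrArg Prod.fst (t.map_add x y)
          rw [this]
          change -((t x).1 + (t y).1) = _
          abel
        map_smul' := by
          intro c x
          have h1 : t (c • x) = algebraMap k A c • t x := by
            rw [← t.map_smul, algebraMap_smul]
          have h2 : ψ.1 (algebraMap k A c) (t x).2 = 0 := by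
            rw [Algebra.algebraMap_eq_smul_one, map_smul, LinearMap.smul_apply, Z1_map_one,
              smul_zero]
          rw [h1, Extension.smul_def]
          simp only [h2, add_zero, algebraMap_smul, RingHom.id_apply, smul_neg] }
    refine ⟨χ, ?_⟩
    ext a m
    have h1 := congrArg Prod.fst (t.map_smul a m)
    have h2 : (t (a • m)).1 = a • (t m).1 + ψ.1 a (t m).2 := h1
    rw [ht] at h2
    change a • (-(t m).1) - (-(t (a • m)).1) = ψ.1 a m
    rw [h2, smul_neg]
    abel
  · intro h
    have h0 : extClass ψ = extClass (0 : Z1 k A M N) :=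
      extClass_eq_of_sub_mem (by simpa using h)
    rw [h0]
    let s : ModuleCat.of A M ⟶ (Extension.shortComplex (0 : Z1 k A M N)).X₂ :=
      ModuleCat.ofHom
        { toFun := fun m => ((0 : N), m)
          map_add' := by
            intro x y
            refine Prod.ext ?_ rfl
            change (0 : N) = 0 + 0
            simp
          map_smul' := by
            intro a x
            refine Prod.ext ?_ rfl
            change (0 : N) = a • (0 : N) + 0
            simp }
    have hs : s ≫ (Extension.shortComplex (0 : Z1 k A M N)).g = 𝟙 _ := rfl
    have h1 := (Extension.shortExact (0 : Z1 k A M N)).comp_extClass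
    have h2 : (Abelian.Ext.mk₀ s).comp ((Abelian.Ext.mk₀
        (Extension.shortComplex (0 : Z1 k A M N)).g).comp
        (Extension.shortExact (0 : Z1 k A M N)).extClass (zero_add 1)) (zero_add 1) = 0 := by
      rw [h1, Abelian.Ext.comp_zero]
    rw [Abelian.Ext.mk₀_comp_mk₀_assoc, hs] at h2
    have h3 := Abelian.Ext.mk₀_id_comp (Extension.shortExact (0 : Z1 k A M N)).extClass
    exact h3.symm.trans h2

theorem hh1ToExt_mk (ψ : Z1 k A M N) :
    hh1ToExt (Submodule.Quotient.mk ψ : HH1 k A M N) = extClass ψ := rfl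

theorem hh1ToExt_eq_zero_iff (x : HH1 k A M N) : hh1ToExt x = 0 ↔ x = 0 := by
  obtain ⟨ψ, rfl⟩ := Submodule.Quotient.mk_surjective _ x
  rw [hh1ToExt_mk, extClass_eq_zero_iff, Submodule.Quotient.mk_eq_zero]

end Extension

/-! ### The Kodaira-Spencer map, its kernel, and the class `lc` -/

section Obstructions

variable (k : Type v) (A M : Type u) [Field k] [CommRing A] [Algebra k A]
  [AddCommGroup M] [Module A M] [Module k M] [IsScalarTower k A M]

variable {k A} in
/-- The derivation `ψ_D : A → End_k(M)`, `ψ_D(a)(m) = D(a) m`. -/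
def psi (D : Derivation k A A) : Z1 k A M M :=
  ⟨LinearMap.mk₂ k (fun (a : A) (m : M) => D a • m)
      (by intro a b m; simp only [map_add, add_smul])
      (by intro c a m; simp only [Derivation.map_smul, smul_assoc])
      (by intro a m n; simp only [smul_add])
      (by intro c a m; simp only [smul_comm (D a) c]),
    by
      intro a b m
      simp only [LinearMap.mk₂_apply, Derivation.leibniz, add_smul, smul_eq_mul, mul_smul,
        smul_comm (D a) b m]⟩

/-- The Kodaira-Spencer map `g : Der_k(A) → Ext¹_A(M, M)`. -/
def kodairaSpencer (D : Derivation k A A) :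
    Abelian.Ext.{u} (ModuleCat.of A M) (ModuleCat.of A M) 1 :=
  hh1ToExt (Submodule.Quotient.mk (psi M D) : HH1 k A M M)

variable {k A M} in
/-- `P ∈ End_k(M)` has the derivation property with respect to `D`. -/
def HasDerivationProperty (D : Derivation k A A) (P : M →ₗ[k] M) : Prop :=
  ∀ (a : A) (m : M), P (a • m) = a • P m + D a • m

theorem kodairaSpencer_eq_zero_iff (D : Derivation k A A) :
    kodairaSpencer k A M D = 0 ↔ ∃ P : M →ₗ[k] M, HasDerivationProperty D P := by
  rw [kodairaSpencer, hh1ToExt_mk, extClass_eq_zero_iff]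
  constructor
  · rintro ⟨χ, hχ⟩
    refine ⟨-χ, fun a m => ?_⟩
    have h : a • χ m - χ (a • m) = D a • m :=
      congrArg (fun f : Z1 k A M M => f.1 a m) hχ
    rw [← h]
    simp only [LinearMap.neg_apply, smul_neg]
    abel
  · rintro ⟨P, hP⟩
    refine ⟨-P, ?_⟩
    ext a m
    change a • (-P m) - (-P (a • m)) = D a • m
    rw [hP, smul_neg]
    abel

/-- The Kodaira-Spencer kernel `V(M) = ker(g) ⊆ Der_k(A)`, an `A`-submodule. -/
def V : Submodule A (Derivation k A A) where
  carrier := {D | kodairaSpencer k A M D = 0}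
  zero_mem' := (kodairaSpencer_eq_zero_iff k A M 0).2 ⟨0, fun a m => by simp⟩
  add_mem' := by
    intro D D' hD hD'
    obtain ⟨P, hP⟩ := (kodairaSpencer_eq_zero_iff k A M D).1 hD
    obtain ⟨P', hP'⟩ := (kodairaSpencer_eq_zero_iff k A M D').1 hD'
    refine (kodairaSpencer_eq_zero_iff k A M _).2 ⟨P + P', fun a m => ?_⟩
    simp only [LinearMap.add_apply, hP a m, hP' a m, Derivation.add_apply, smul_add, add_smul]
    abel
  smul_mem' := by
    intro b D hD
    obtain ⟨P, hP⟩ := (kodairaSpencer_eq_zero_iff k A M D).1 hD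
    refine (kodairaSpencer_eq_zero_iff k A M _).2 ⟨b • P, fun a m => ?_⟩
    simp only [LinearMap.smul_apply, hP a m, Derivation.smul_apply, smul_add, smul_assoc,
      smul_comm b a]

theorem mem_V_iff (D : Derivation k A A) :
    D ∈ V k A M ↔ kodairaSpencer k A M D = 0 := Iff.rfl

/-- A `k`-linear `V(M)`-connection on `M`: a `k`-linear map `∇ : V(M) → End_k(M)` such that each
`∇_D` has the derivation property with respect to `D`. -/
structure KLinearConnection where
  toLinearMap : V k A M →ₗ[k] (M →ₗ[k] M)
  derivation_property : ∀ D : V k A M, HasDerivationProperty D.1 (toLinearMap D)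

instance : Nonempty (KLinearConnection k A M) := by
  let c : Submodule k (V k A M × (M →ₗ[k] M)) :=
    { carrier := {x | HasDerivationProperty x.1.1 x.2}
      zero_mem' := by intro a m; simp
      add_mem' := by
        intro x y hx hy a m
        simp only [Prod.snd_add, Prod.fst_add, LinearMap.add_apply, hx a m, hy a m,
          Submodule.coe_add, Derivation.add_apply, smul_add, add_smul]
        abel
      smul_mem' := by
        intro b x hx a m
        have h : ((b • x).1 : Derivation k A A) = b • x.1.1 := rfl
        simp only [Prod.smul_snd, h, LinearMap.smul_apply, hx a m, Derivation.smul_apply,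
          smul_add, smul_assoc, smul_comm b a] }
  let p : c →ₗ[k] V k A M := (LinearMap.fst k _ _).comp c.subtype
  have hp : LinearMap.range p = ⊤ := by
    rw [LinearMap.range_eq_top]
    intro D
    obtain ⟨P, hP⟩ := (kodairaSpencer_eq_zero_iff k A M D.1).1 D.2
    exact ⟨⟨(D, P), hP⟩, rfl⟩
  obtain ⟨s, hs⟩ := p.exists_rightInverse_of_surjective hp
  refine ⟨⟨(LinearMap.snd k _ _).comp (c.subtype.comp s), fun D => ?_⟩⟩
  have h1 : (s D).1.1 = D := congrArg (fun f : V k A M →ₗ[k] V k A M => f D) hs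
  have h2 := (s D).2
  change HasDerivationProperty (s D).1.1.1 (s D).1.2 at h2
  rw [h1] at h2
  exact h2

variable {k A M}

/-- The derivation `φ : A → Hom_k(V(M), End_A(M))`, `φ(a)(D) = a ∇_D - ∇_{aD}`. -/
def KLinearConnection.phi (c : KLinearConnection k A M) :
    Z1 k A (V k A M) (Module.End A M) :=
  ⟨LinearMap.mk₂ k
      (fun (a : A) (D : V k A M) =>
        ({ toFun := fun m => a • c.toLinearMap D m - c.toLinearMap (a • D) m
           map_add' := by
            intro x y
            simp only [map_add, smul_add]
            abel
           map_smul' := by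
            intro b x
            have h : ((a • D : V k A M) : Derivation k A A) b = a • D.1 b := rfl
            simp only [c.derivation_property _ b x, h, smul_add, smul_sub, smul_assoc,
              smul_comm a b, RingHom.id_apply]
            abel } : Module.End A M))
      (by
        intro a b D
        ext m
        simp only [LinearMap.coe_mk, AddHom.coe_mk, LinearMap.add_apply, add_smul, map_add]
        abel)
      (by
        intro r a D
        ext m
        simp only [LinearMap.coe_mk, AddHom.coe_mk, LinearMap.smul_apply, smul_assoc, map_smul,
          smul_sub])
      (by
        intro a D D'
        ext m
        simp only [LinearMap.coe_mk, AddHom.coe_mk, LinearMap.add_apply, smul_add, map_add]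
        abel)
      (by
        intro r a D
        ext m
        simp only [LinearMap.coe_mk, AddHom.coe_mk, LinearMap.smul_apply, smul_comm a r, map_smul,
          smul_sub]),
    by
      intro a b D
      ext m
      simp only [LinearMap.mk₂_apply, LinearMap.coe_mk, AddHom.coe_mk, LinearMap.add_apply,
        LinearMap.smul_apply, mul_smul, smul_sub]
      abel⟩

@[simp]
theorem KLinearConnection.phi_apply (c : KLinearConnection k A M) (a : A) (D : V k A M) (m : M) :
    c.phi.1 a D m = a • c.toLinearMap D m - c.toLinearMap (a • D) m := rfl

/-- The class of `φ` in `HH¹(A, Hom_k(V(M), End_A(M)))` does not depend on `∇`. -/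
theorem KLinearConnection.phi_class_eq (c c' : KLinearConnection k A M) :
    (Submodule.Quotient.mk c.phi : HH1 k A (V k A M) (Module.End A M)) =
      Submodule.Quotient.mk c'.phi := by
  rw [Submodule.Quotient.eq]
  let χ : V k A M →ₗ[k] Module.End A M :=
    { toFun := fun D =>
        { toFun := fun m => c.toLinearMap D m - c'.toLinearMap D m
          map_add' := by
            intro x y
            simp only [map_add]
            abel
          map_smul' := by
            intro b x
            simp only [c.derivation_property _ b x, c'.derivation_property _ b x, smul_sub,
              RingHom.id_apply]
            abel }
      map_add' := by
        intro D D'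
        ext m
        simp only [LinearMap.coe_mk, AddHom.coe_mk, LinearMap.add_apply, map_add]
        abel
      map_smul' := by
        intro r D
        ext m
        simp only [LinearMap.coe_mk, AddHom.coe_mk, LinearMap.smul_apply, map_smul, smul_sub,
          RingHom.id_apply] }
  refine ⟨χ, ?_⟩
  ext a D m
  change a • (c.toLinearMap D m - c'.toLinearMap D m) -
      (c.toLinearMap (a • D) m - c'.toLinearMap (a • D) m) =
    (a • c.toLinearMap D m - c.toLinearMap (a • D) m) -
      (a • c'.toLinearMap D m - c'.toLinearMap (a • D) m)
  rw [smul_sub]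
  abel

variable (k A M)

/-- The class `lc(M) ∈ Ext¹_A(V(M), End_A(M))`, the class of `φ` for any choice of a `k`-linear
`V(M)`-connection on `M`. -/
def lc : Abelian.Ext.{u} (ModuleCat.of A (V k A M)) (ModuleCat.of A (Module.End A M)) 1 :=
  hh1ToExt (Submodule.Quotient.mk (Classical.arbitrary (KLinearConnection k A M)).phi :
    HH1 k A (V k A M) (Module.End A M))

theorem lc_eq (c : KLinearConnection k A M) :
    lc k A M = hh1ToExt (Submodule.Quotient.mk c.phi :
      HH1 k A (V k A M) (Module.End A M)) := by
  rw [lc, KLinearConnection.phi_class_eq]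

end Obstructions

/-- `M` is locally free on `Spec A ∖ {m}`. -/
def LocallyFreeAwayFrom {A : Type u} [CommRing A] (m : Ideal A)
    (M : Type u) [AddCommGroup M] [Module A M] : Prop :=
  ∀ p : PrimeSpectrum A, p.asIdeal ≠ m →
    Module.Free (Localization.AtPrime p.asIdeal) (LocalizedModule p.asIdeal.primeCompl M)

/-- The actions of `k` on the completions of `A` and of `M` are compatible. -/
instance adicCompletion_isScalarTower (k : Type v) (A M : Type u) [Field k] [CommRing A]
    [Algebra k A] [AddCommGroup M] [Module A M] [Module k M] [IsScalarTower k A M]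
    (m : Ideal A) : IsScalarTower k (AdicCompletion m A) (AdicCompletion m M) :=
  ⟨fun c x y => by
    have h1 : c • x = algebraMap k A c • x := by
      ext n
      simp [AdicCompletion.val_smul_apply]
    have h2 : c • (x • y) = algebraMap k A c • (x • y) := by
      ext n
      simp [AdicCompletion.val_smul_apply]
    rw [h1, h2, smul_assoc]⟩

end

end KodairaSpencer

/-!
The Atiyah module of `M` is the `A`-module of pairs `(D, P)` of a derivation `D` of `A` and a
`k`-linear map `P : M → M` with `P (a m) = a P m + D a m`; its symbol `(D, P) ↦ D` has image `V(M)`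
and kernel `End_A(M)`. So `V(M) = Der_k(A)` says that the cokernel of the symbol is zero, and
`lc(M) = 0` says that the symbol splits over its image, which is again the vanishing of a cokernel
of finitely generated modules. Both cokernels commute with flat base change `A → B` along which
every derivation `A → B` extends uniquely to `B`, as is the case for localizations and adic
completions. They vanish when `M` is free, so here their support lies in `{m}`, and a finitely
generated module with such a support is zero as soon as its base change to some `B` is zero for
which the image of `Spec B → Spec A` contains `m`.
-/

namespace KodairaSpencer

noncomputable section

/-! ### Flat base change of homomorphisms, kernels and cokernels -/

section BaseChange

variable {R S M N P Q : Type*} [CommRing R] [CommRing S] [Algebra R S]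
  [AddCommGroup M] [Module R M] [AddCommGroup N] [Module R N]
  [AddCommGroup P] [Module R P] [Module S P] [IsScalarTower R S P]

theorem isBaseChange_compRight [Module.Flat R S] [Module.FinitePresentation R M]
    {ε : N →ₗ[R] P} (h : IsBaseChange S ε) :
    IsBaseChange S (LinearMap.compRight R ε (M := M)) := by
  obtain ⟨n, t, q, g, hq, hgq⟩ := Module.FinitePresentation.exists_fin' R M
  exact IsBaseChange.of_left_exact S (f := LinearMap.lcomp R N q) (g := LinearMap.lcomp R N g)
    (f' := LinearMap.lcomp S P q) (g' := LinearMap.lcomp S P g) _ _ _ rfl rfl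
    (h.linearMapRight (Fin n → R)) (h.linearMapRight (Fin t → R))
    (LinearMap.exact_lcomp_of_exact_of_surjective _ hgq hq)
    (LinearMap.lcomp_injective_of_surjective q hq)
    (LinearMap.exact_lcomp_of_exact_of_surjective _ hgq hq)
    (LinearMap.lcomp_injective_of_surjective q hq)

variable [AddCommGroup Q] [Module R Q] [Module S Q] [IsScalarTower R S Q]

theorem isBaseChange_linearMapLeftRightHom [Module.Flat R S] [Module.FinitePresentation R M]
    {α : M →ₗ[R] P} (hα : IsBaseChange S α) {β : N →ₗ[R] Q} (hβ : IsBaseChange S β) :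
    IsBaseChange S (IsBaseChange.linearMapLeftRightHom hα β) := by
  refine IsBaseChange.of_equiv ((isBaseChange_compRight (M := M) hβ).equiv ≪≫ₗ
    LinearMap.liftBaseChangeEquiv S ≪≫ₗ LinearEquiv.congrLeft Q S hα.equiv) fun f => ?_
  ext p
  simp [IsBaseChange.equiv_tmul, LinearEquiv.congrLeft, IsBaseChange.linearMapLeftRightHom_apply]

theorem exists_isBaseChange_quotient_range {α : M →ₗ[R] P} {β : N →ₗ[R] Q}
    (hα : IsBaseChange S α) (hβ : IsBaseChange S β) {f : M →ₗ[R] N} {g : P →ₗ[S] Q}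
    (comm : ∀ x, β (f x) = g (α x)) :
    ∃ γ : (N ⧸ LinearMap.range f) →ₗ[R] (Q ⧸ LinearMap.range g),
      IsBaseChange S γ ∧ ∀ x, γ (Submodule.Quotient.mk x) = Submodule.Quotient.mk (β x) := by
  let γ : (N ⧸ LinearMap.range f) →ₗ[R] (Q ⧸ LinearMap.range g) :=
    (LinearMap.range f).liftQ ((LinearMap.range g).mkQ.restrictScalars R ∘ₗ β) (by
      rintro _ ⟨x, rfl⟩
      simp [comm])
  have hγ : ∀ x, γ (Submodule.Quotient.mk x) = Submodule.Quotient.mk (β x) := fun x => by simp [γ]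
  exact ⟨γ, IsBaseChange.of_right_exact S α β γ (LinearMap.ext comm) (LinearMap.ext hγ) hα hβ
    (LinearMap.exact_map_mkQ_range f) (Submodule.mkQ_surjective _)
    (LinearMap.exact_map_mkQ_range g) (Submodule.mkQ_surjective _), hγ⟩

theorem exists_isBaseChange_range [Module.Flat R S] {α : M →ₗ[R] P} {β : N →ₗ[R] Q}
    (hα : IsBaseChange S α) (hβ : IsBaseChange S β) {f : M →ₗ[R] N} {g : P →ₗ[S] Q}
    (comm : ∀ x, β (f x) = g (α x)) :
    ∃ γ : LinearMap.range f →ₗ[R] LinearMap.range g,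
      IsBaseChange S γ ∧ ∀ x, (γ x : Q) = β x := by
  obtain ⟨δ, hδ, hδ_mk⟩ := exists_isBaseChange_quotient_range hα hβ comm
  let γ : LinearMap.range f →ₗ[R] LinearMap.range g :=
    (β ∘ₗ (LinearMap.range f).subtype).codRestrict ((LinearMap.range g).restrictScalars R) (by
      rintro ⟨_, x, rfl⟩
      exact ⟨α x, (comm x).symm⟩)
  exact ⟨γ, IsBaseChange.of_left_exact S (f' := (LinearMap.range g).subtype)
    (g' := (LinearMap.range g).mkQ) γ β δ rfl (LinearMap.ext hδ_mk) hβ hδ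
    (LinearMap.exact_subtype_mkQ _) (Submodule.subtype_injective _)
    (LinearMap.exact_subtype_mkQ _) (Submodule.subtype_injective _), fun _ => rfl⟩

end BaseChange

/-! ### The obstruction to splitting a homomorphism onto its range -/

section Splitting

variable {R M N : Type*} [CommRing R] [AddCommGroup M] [Module R M] [AddCommGroup N] [Module R N]

/-- The cokernel of `f ∘ -: Hom(f(M), M) → Hom(f(M), f(M))`. It vanishes if and only if the
surjection `M → f(M)` splits, and unlike the class of this extension in `Ext¹(f(M), ker f)` it is
a module whose formation visibly commutes with flat base change. -/
abbrev SplittingCokernel (f : M →ₗ[R] N) : Type _ :=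
  (LinearMap.range f →ₗ[R] LinearMap.range f) ⧸
    LinearMap.range (LinearMap.compRight R f.rangeRestrict (M := LinearMap.range f))

theorem subsingleton_splittingCokernel_iff (f : M →ₗ[R] N) :
    Subsingleton (SplittingCokernel f) ↔
      ∃ s : LinearMap.range f →ₗ[R] M, f.rangeRestrict ∘ₗ s = LinearMap.id := by
  rw [Submodule.Quotient.subsingleton_iff, LinearMap.range_eq_top]
  exact ⟨fun h => h LinearMap.id, fun ⟨s, hs⟩ g => ⟨s ∘ₗ g, by
    rw [LinearMap.compRight_apply, ← LinearMap.comp_assoc, hs, LinearMap.id_comp]⟩⟩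

theorem exists_isBaseChange_splittingCokernel {S P Q : Type*} [CommRing S] [Algebra R S]
    [Module.Flat R S] [AddCommGroup P] [Module R P] [Module S P] [IsScalarTower R S P]
    [AddCommGroup Q] [Module R Q] [Module S Q] [IsScalarTower R S Q]
    {α : M →ₗ[R] P} {β : N →ₗ[R] Q} (hα : IsBaseChange S α) (hβ : IsBaseChange S β)
    {f : M →ₗ[R] N} {g : P →ₗ[S] Q} (comm : ∀ x, β (f x) = g (α x))
    [Module.FinitePresentation R (LinearMap.range f)] :
    ∃ γ : SplittingCokernel f →ₗ[R] SplittingCokernel g, IsBaseChange S γ := by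
  obtain ⟨ρ, hρ, hρ_coe⟩ := exists_isBaseChange_range hα hβ comm
  have hρ_apply : ∀ x, ρ (f.rangeRestrict x) = g.rangeRestrict (α x) := fun x =>
    Subtype.ext ((hρ_coe _).trans (comm x))
  obtain ⟨γ, hγ, -⟩ := exists_isBaseChange_quotient_range
    (isBaseChange_linearMapLeftRightHom hρ hα) (isBaseChange_linearMapLeftRightHom hρ hρ)
    (f := LinearMap.compRight R f.rangeRestrict) (g := LinearMap.compRight S g.rangeRestrict)
    fun h => hρ.algHom_ext _ _ fun x => by
      simp only [IsBaseChange.linearMapLeftRightHom_comp_apply, LinearMap.compRight_apply,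
        LinearMap.comp_apply, hρ_apply]
  exact ⟨γ, hγ⟩

end Splitting

/-! ### Support and base change -/

section Support

open TensorProduct

variable {R S M N : Type*} [CommRing R] [CommRing S] [Algebra R S] [AddCommGroup M] [Module R M]
  [Module.Finite R M] [AddCommGroup N] [Module R N] [Module S N] [IsScalarTower R S N]

theorem comap_notMem_support_of_isBaseChange {f : M →ₗ[R] N} (hf : IsBaseChange S f)
    [Subsingleton N] (q : PrimeSpectrum S) :
    PrimeSpectrum.comap (algebraMap R S) q ∉ Module.support R M := by
  intro hq
  set p := PrimeSpectrum.comap (algebraMap R S) q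
  have : Nontrivial (p.asIdeal.ResidueField ⊗[R] M) :=
    (Module.mem_support_iff_nontrivial_residueField_tensorProduct p).1 hq
  let φ : p.asIdeal.ResidueField →ₐ[R] q.asIdeal.ResidueField :=
    Ideal.ResidueField.mapₐ p.asIdeal q.asIdeal (Algebra.ofId R S) rfl
  let := φ.toRingHom.toAlgebra
  have := IsScalarTower.of_algHom φ
  have : Nontrivial (q.asIdeal.ResidueField ⊗[R] M) :=
    (AlgebraTensorModule.cancelBaseChange R p.asIdeal.ResidueField q.asIdeal.ResidueField
      q.asIdeal.ResidueField M).symm.nontrivial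
  have : Nontrivial (q.asIdeal.ResidueField ⊗[S] (S ⊗[R] M)) :=
    (AlgebraTensorModule.cancelBaseChange R S q.asIdeal.ResidueField
      q.asIdeal.ResidueField M).nontrivial
  have : Subsingleton (S ⊗[R] M) := hf.equiv.subsingleton
  exact not_subsingleton (q.asIdeal.ResidueField ⊗[S] (S ⊗[R] M)) inferInstance

theorem subsingleton_iff_of_support_subset {p : PrimeSpectrum R}
    (hM : Module.support R M ⊆ {p})
    (hp : p ∈ Set.range (PrimeSpectrum.comap (algebraMap R S)))
    {f : M →ₗ[R] N} (hf : IsBaseChange S f) : Subsingleton M ↔ Subsingleton N := by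
  refine ⟨fun _ => hf.equiv.symm.injective.subsingleton, fun _ => ?_⟩
  obtain ⟨q, rfl⟩ := hp
  rw [← Module.support_eq_empty_iff (R := R)]
  refine Set.eq_empty_of_forall_notMem fun p hp => ?_
  obtain rfl := hM hp
  exact comap_notMem_support_of_isBaseChange hf q hp

end Support

/-! ### Atiyah modules -/

section AtiyahAlong

variable (k : Type*) {A : Type*} (B : Type*) {L M N : Type*} [CommRing k]
  [CommRing A] [Algebra k A] [CommRing B] [Algebra k B] [Algebra A B]
  [AddCommGroup L] [Module A L] [Module k L] [AddCommGroup M] [Module A M] [Module k M]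
  [AddCommGroup N] [Module A N] [Module B N] [Module k N]
  [IsScalarTower k B N] [IsScalarTower A B N]

/-- The Atiyah module along an `A`-linear map `ι : M → N` to a `B`-module: pairs `(D, P)` of a
derivation `D : A → B` and a `k`-linear map `P : M → N` with `P(am) = a P(m) + D(a) ι(m)`. -/
def AtiyahAlong (ι : M →ₗ[A] N) : Submodule B (Derivation k A B × (M →ₗ[k] N)) where
  carrier := {x | ∀ (a : A) (m : M), x.2 (a • m) = a • x.2 m + x.1 a • ι m}
  zero_mem' := by intro a m; simp
  add_mem' := by
    intro x y hx hy a m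
    simp only [Prod.snd_add, Prod.fst_add, LinearMap.add_apply, hx a m, hy a m,
      Derivation.add_apply, smul_add, add_smul]
    abel
  smul_mem' := by
    intro b x hx a m
    simp only [Prod.smul_snd, Prod.smul_fst, LinearMap.smul_apply, hx a m,
      Derivation.smul_apply, smul_add, smul_assoc, smul_comm b a]

/-- The Atiyah module of `M`: pairs of a derivation `D` and a `k`-linear endomorphism of `M` with
the derivation property with respect to `D`. -/
abbrev Atiyah (A M : Type*) [CommRing A] [Algebra k A] [AddCommGroup M] [Module A M] [Module k M]
    [IsScalarTower k A M] : Submodule A (Derivation k A A × (M →ₗ[k] M)) :=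
  AtiyahAlong k A (LinearMap.id : M →ₗ[A] M)

/-- The symbol map `(D, P) ↦ D` of the Atiyah module. -/
def Atiyah.symbol (k A M : Type*) [CommRing k] [CommRing A] [Algebra k A] [AddCommGroup M]
    [Module A M] [Module k M] [IsScalarTower k A M] : Atiyah k A M →ₗ[A] Derivation k A A :=
  LinearMap.fst A _ _ ∘ₗ (Atiyah k A M).subtype

variable {k B}

theorem AtiyahAlong.leibniz {ι : M →ₗ[A] N} (x : AtiyahAlong k B ι) (a : A) (m : M) :
    x.1.2 (a • m) = a • x.1.2 m + x.1.1 a • ι m := x.2 a m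

@[ext]
theorem AtiyahAlong.ext {ι : M →ₗ[A] N} {x y : AtiyahAlong k B ι}
    (h₁ : ∀ a, x.1.1 a = y.1.1 a) (h₂ : ∀ m, x.1.2 m = y.1.2 m) : x = y :=
  Subtype.ext (Prod.ext (Derivation.ext h₁) (LinearMap.ext h₂))

/-- Precomposition `(D, P) ↦ (D, P ∘ q)` with an `A`-linear map `q : L → M`. -/
def AtiyahAlong.comp [IsScalarTower k A L] [IsScalarTower k A M] (ι : M →ₗ[A] N) (q : L →ₗ[A] M) :
    AtiyahAlong k B ι →ₗ[B] AtiyahAlong k B (ι ∘ₗ q) where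
  toFun x := ⟨(x.1.1, x.1.2 ∘ₗ q.restrictScalars k), fun a l => by simp [AtiyahAlong.leibniz x]⟩
  map_add' _ _ := rfl
  map_smul' _ _ := rfl

theorem AtiyahAlong.comp_injective [IsScalarTower k A L] [IsScalarTower k A M] (ι : M →ₗ[A] N)
    {q : L →ₗ[A] M} (hq : Function.Surjective q) :
    Function.Injective (AtiyahAlong.comp (k := k) (B := B) ι q) := fun x y h => by
  ext m
  · exact congrArg (fun z => z.1.1 m) h
  · obtain ⟨l, rfl⟩ := hq m
    exact congrArg (fun z => z.1.2 l) h

/-- Restriction `(D, P) ↦ P ∘ g` to the relations `g : L → F` of a presentation `q : F → M`. It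
has values in the `A`-linear maps, because the Leibniz term `D(a) ι(q(g(l)))` vanishes. -/
def AtiyahAlong.restrictRelations {F : Type*} [AddCommGroup F] [Module A F] [Module k F]
    (ι : M →ₗ[A] N) {g : L →ₗ[A] F} {q : F →ₗ[A] M} (hgq : Function.Exact g q) :
    AtiyahAlong k B (ι ∘ₗ q) →ₗ[B] (L →ₗ[A] N) where
  toFun x :=
    { toFun := fun l => x.1.2 (g l)
      map_add' := by simp
      map_smul' := fun a l => by
        rw [map_smul, AtiyahAlong.leibniz, LinearMap.comp_apply, hgq.apply_apply_eq_zero, map_zero,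
          smul_zero, add_zero, RingHom.id_apply] }
  map_add' _ _ := rfl
  map_smul' _ _ := rfl

omit [Module k L] in
theorem AtiyahAlong.exact_comp_restrictRelations {F : Type*} [AddCommGroup F] [Module A F]
    [Module k F] [IsScalarTower k A F] [IsScalarTower k A M] (ι : M →ₗ[A] N) {g : L →ₗ[A] F}
    {q : F →ₗ[A] M} (hgq : Function.Exact g q) (hq : Function.Surjective q) :
    Function.Exact (AtiyahAlong.comp (k := k) (B := B) ι q)
      (AtiyahAlong.restrictRelations ι hgq) := by
  intro y
  constructor
  · intro hy
    have hker : LinearMap.ker (q.restrictScalars k) ≤ LinearMap.ker y.1.2 := fun x hx => by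
      obtain ⟨l, rfl⟩ := (hgq x).1 hx
      exact LinearMap.congr_fun hy l
    let P : M →ₗ[k] N := (LinearMap.ker (q.restrictScalars k)).liftQ y.1.2 hker ∘ₗ
      ((q.restrictScalars k).quotKerEquivOfSurjective hq).symm.toLinearMap
    have hP_apply : ∀ x, P (q x) = y.1.2 x := fun x =>
      congrArg _ ((q.restrictScalars k).quotKerEquivOfSurjective_symm_apply hq x)
    refine ⟨⟨(y.1.1, P), fun a m => ?_⟩, AtiyahAlong.ext (fun _ => rfl) hP_apply⟩
    obtain ⟨x, rfl⟩ := hq m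
    rw [← map_smul, hP_apply, hP_apply, AtiyahAlong.leibniz, LinearMap.comp_apply]
  · rintro ⟨x, rfl⟩
    ext l
    exact (congrArg x.1.2 (hgq.apply_apply_eq_zero l)).trans (map_zero _)

/-- The `k`-linear extension `∑ aⱼ bⱼ ↦ ∑ (aⱼ pⱼ + D(aⱼ) ι(bⱼ))` of values `p` on a basis `b`,
which is the only one that satisfies the Leibniz rule. -/
def leibnizExtension {J : Type*} [IsScalarTower k A M] [IsScalarTower k A N]
    (b : Module.Basis J A M) (ι : M →ₗ[A] N) (D : Derivation k A B) (p : J → N) : M →ₗ[k] N :=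
  Finsupp.lsum k (fun j => (LinearMap.toSpanSingleton A N (p j)).restrictScalars k +
    (LinearMap.toSpanSingleton B N (ι (b j))).restrictScalars k ∘ₗ D.toLinearMap) ∘ₗ
      b.repr.toLinearMap.restrictScalars k

omit [IsScalarTower A B N] in
theorem leibnizExtension_smul_basis {J : Type*} [IsScalarTower k A M] [IsScalarTower k A N]
    (b : Module.Basis J A M) (ι : M →ₗ[A] N) (D : Derivation k A B) (p : J → N) (a : A) (j : J) :
    leibnizExtension b ι D p (a • b j) = a • p j + D a • ι (b j) := by
  simp [leibnizExtension]

theorem leibnizExtension_smul {J : Type*} [IsScalarTower k A M] [IsScalarTower k A N]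
    (b : Module.Basis J A M) (ι : M →ₗ[A] N) (D : Derivation k A B) (p : J → N) (a : A) (m : M) :
    leibnizExtension b ι D p (a • m) = a • leibnizExtension b ι D p m + D a • ι m := by
  rw [← b.linearCombination_repr m]
  induction b.repr m using Finsupp.induction_linear with
  | zero => simp
  | add f g hf hg =>
    simp only [map_add, smul_add, hf, hg]
    abel
  | single j c =>
    rw [Finsupp.linearCombination_single, ← mul_smul, leibnizExtension_smul_basis,
      leibnizExtension_smul_basis, D.leibniz, map_smul]
    simp only [add_smul, smul_add, mul_smul, smul_assoc, smul_comm (D a) c]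
    abel

/-- The isomorphism `(D, P) ↦ (D, P ∘ b)` for a basis `b` of the source: the Leibniz rule determines
`P` from `D` and its arbitrary values on `b`. -/
def AtiyahAlong.equivOfBasis {J : Type*} [IsScalarTower k A M] [IsScalarTower k A N]
    (b : Module.Basis J A M) (ι : M →ₗ[A] N) :
    AtiyahAlong k B ι ≃ₗ[B] Derivation k A B × (J → N) :=
  LinearEquiv.ofBijective
    { toFun := fun x => (x.1.1, x.1.2 ∘ b)
      map_add' := fun _ _ => rfl
      map_smul' := fun _ _ => rfl } <| by
    refine ⟨fun x y h => ?_, fun ⟨D, p⟩ => ⟨⟨(D, leibnizExtension b ι D p),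
      leibnizExtension_smul b ι D p⟩, Prod.ext rfl (funext fun j => ?_)⟩⟩
    · obtain ⟨hD, hP⟩ : x.1.1 = y.1.1 ∧ x.1.2 ∘ b = y.1.2 ∘ b := Prod.ext_iff.1 h
      ext m
      · rw [hD]
      · induction b.mem_span m using Submodule.span_induction with
        | mem _ hm =>
          obtain ⟨j, rfl⟩ := hm
          exact congrFun hP j
        | zero => simp
        | add m m' _ _ hm hm' => rw [map_add, map_add, hm, hm']
        | smul a m _ hm => rw [AtiyahAlong.leibniz, AtiyahAlong.leibniz, hm, hD]
    · have := leibnizExtension_smul_basis b ι D p 1 j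
      simpa using this

end AtiyahAlong

section AtiyahBaseChange

open KaehlerDifferential

variable {k A B L M N : Type*} [CommRing k] [CommRing A] [Algebra k A] [CommRing B] [Algebra k B]
  [Algebra A B] [IsScalarTower k A B]

theorem isBaseChange_compDer [Module.FinitePresentation A Ω[A⁄k]] [Module.Flat A B] :
    IsBaseChange B ((Algebra.linearMap A B).compDer (R := k)) := by
  let e : (Ω[A⁄k] →ₗ[A] B) ≃ₗ[B] Derivation k A B :=
    { linearMapEquivDerivation k A with map_smul' := fun b f => by ext; rfl }
  refine (IsBaseChange.iff_of_equiv_comm (linearMapEquivDerivation k A) e ?_).1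
    (isBaseChange_compRight (M := Ω[A⁄k]) (IsBaseChange.linearMap A B))
  ext
  rfl

variable [AddCommGroup L] [Module A L] [Module k L] [IsScalarTower k A L]
  [AddCommGroup M] [Module A M] [Module k M] [IsScalarTower k A M]
  [AddCommGroup N] [Module B N] [Module k N] [IsScalarTower k B N]
  [Module A N] [IsScalarTower A B N] [IsScalarTower k A N]

variable (k) in
/-- Composition of both components of an Atiyah module with `A → B` and with `ι : M → N`. -/
def AtiyahAlong.map (ι : M →ₗ[A] N) (q : L →ₗ[A] M) :
    AtiyahAlong k A q →ₗ[A] AtiyahAlong k B (ι ∘ₗ q) where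
  toFun x := ⟨((Algebra.linearMap A B).compDer x.1.1, ι.restrictScalars k ∘ₗ x.1.2), fun a l => by
    simp [AtiyahAlong.leibniz x]⟩
  map_add' x y := by ext <;> simp
  map_smul' a x := by ext <;> simp [Algebra.smul_def]

theorem AtiyahAlong.isBaseChange_map_of_basis [Module.FinitePresentation A Ω[A⁄k]]
    [Module.Flat A B] {J : Type*} [Finite J] (b : Module.Basis J A L) {ι : M →ₗ[A] N}
    (hι : IsBaseChange B ι) (q : L →ₗ[A] M) : IsBaseChange B (AtiyahAlong.map k ι q (B := B)) := by
  refine (IsBaseChange.iff_of_equiv_comm (AtiyahAlong.equivOfBasis b q)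
    (AtiyahAlong.equivOfBasis b (ι ∘ₗ q)) ?_).2
    (isBaseChange_compDer.prodMap _ _ (IsBaseChange.pi (fun _ : J => ι) fun _ => hι))
  rfl

theorem AtiyahAlong.isBaseChange_map [Module.FinitePresentation A Ω[A⁄k]] [Module.Flat A B]
    [Module.FinitePresentation A L] {ι : M →ₗ[A] N} (hι : IsBaseChange B ι) (q : L →ₗ[A] M) :
    IsBaseChange B (AtiyahAlong.map k ι q (B := B)) := by
  obtain ⟨n, t, p, g, hp, hgp⟩ := Module.FinitePresentation.exists_fin' A L
  have comm_comp : AtiyahAlong.map k ι (q ∘ₗ p) ∘ₗ AtiyahAlong.comp q p =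
      (AtiyahAlong.comp (k := k) (ι ∘ₗ q) p).restrictScalars A ∘ₗ
        AtiyahAlong.map k ι q (B := B) := rfl
  have comm_relations : LinearMap.compRight A ι ∘ₗ AtiyahAlong.restrictRelations q hgp =
      (AtiyahAlong.restrictRelations (k := k) (B := B) (ι ∘ₗ q) hgp).restrictScalars A ∘ₗ
        AtiyahAlong.map k ι (q ∘ₗ p) := rfl
  exact IsBaseChange.of_left_exact B _ _ _ comm_comp comm_relations
    (AtiyahAlong.isBaseChange_map_of_basis (Pi.basisFun A (Fin n)) hι (q ∘ₗ p))
    (hι.linearMapRight (Fin t → A))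
    (AtiyahAlong.exact_comp_restrictRelations q hgp hp) (AtiyahAlong.comp_injective q hp)
    (AtiyahAlong.exact_comp_restrictRelations (ι ∘ₗ q) hgp hp)
    (AtiyahAlong.comp_injective (ι ∘ₗ q) hp)

variable (B) in
/-- Restriction of both components of the Atiyah module of `N` along `A → B` and `ι : M → N`. -/
def Atiyah.restrict (ι : M →ₗ[A] N) : Atiyah k B N →ₗ[B] AtiyahAlong k B ι where
  toFun x := ⟨(x.1.1.compAlgebraMap A, x.1.2 ∘ₗ ι.restrictScalars k), fun a m => by
    simpa using AtiyahAlong.leibniz x (algebraMap A B a) (ι m)⟩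
  map_add' _ _ := rfl
  map_smul' _ _ := rfl

theorem Atiyah.restrict_injective
    (hder : Function.Injective (Derivation.compAlgebraMapL k A B B)) {ι : M →ₗ[A] N}
    (hι : IsBaseChange B ι) : Function.Injective (Atiyah.restrict (k := k) B ι) := by
  intro x y h
  have hD : x.1.1 = y.1.1 := hder (congrArg (fun z => z.1.1) h)
  ext n
  · rw [hD]
  · induction n using hι.inductionOn with
    | zero => simp
    | tmul m => exact LinearMap.congr_fun (congrArg (fun z => z.1.2) h) m
    | smul b n hn => rw [AtiyahAlong.leibniz, AtiyahAlong.leibniz, hD, hn]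
    | add n n' hn hn' => rw [map_add, map_add, hn, hn']

open TensorProduct

/-- The additive map `b ⊗ m ↦ b P(m) + D(b) ι(m)` on `B ⊗ M`, where `x = (D|_A, P)`. -/
def AtiyahAlong.tensorExtension {ι : M →ₗ[A] N} (x : AtiyahAlong k B ι) (D : Derivation k B B)
    (hD : ∀ a, D (algebraMap A B a) = x.1.1 a) : B ⊗[A] M →+ N :=
  liftAddHom
    (AddMonoidHom.mk' (fun b => (DistribSMul.toAddMonoidHom N b).comp x.1.2.toAddMonoidHom +
      (DistribSMul.toAddMonoidHom N (D b)).comp ι.toAddMonoidHom) fun b c => by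
        ext m
        simp only [AddMonoidHom.add_apply, AddMonoidHom.comp_apply, map_add, add_smul,
          DistribSMul.toAddMonoidHom_apply]
        abel)
    fun a b m => by
      simp only [AddMonoidHom.mk'_apply, AddMonoidHom.add_apply, AddMonoidHom.comp_apply,
        DistribSMul.toAddMonoidHom_apply, LinearMap.toAddMonoidHom_coe, AtiyahAlong.leibniz x,
        map_smul, Algebra.smul_def a b, D.leibniz, hD, smul_add, add_smul, mul_smul,
        algebraMap_smul, smul_eq_mul]
      rw [smul_comm b a, smul_comm (D b) a]
      abel

omit [IsScalarTower k A B] [IsScalarTower k A M] [IsScalarTower k A N] in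
theorem AtiyahAlong.tensorExtension_tmul {ι : M →ₗ[A] N} (x : AtiyahAlong k B ι)
    (D : Derivation k B B) (hD : ∀ a, D (algebraMap A B a) = x.1.1 a) (b : B) (m : M) :
    tensorExtension x D hD (b ⊗ₜ m) = b • x.1.2 m + D b • ι m := rfl

omit [IsScalarTower k A B] [IsScalarTower k A M] [IsScalarTower k A N] in
theorem AtiyahAlong.tensorExtension_smul {ι : M →ₗ[A] N} (hι : IsBaseChange B ι)
    (x : AtiyahAlong k B ι) (D : Derivation k B B) (hD : ∀ a, D (algebraMap A B a) = x.1.1 a)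
    (b : B) (z : B ⊗[A] M) :
    tensorExtension x D hD (b • z) = b • tensorExtension x D hD z + D b • hι.equiv z := by
  induction z with
  | zero => simp
  | tmul c m =>
    simp only [smul_tmul', tensorExtension_tmul, hι.equiv_tmul, smul_eq_mul, D.leibniz, add_smul,
      smul_add, mul_smul]
    rw [smul_comm c (D b)]
    abel
  | add z w hz hw =>
    simp only [smul_add, map_add, hz, hw]
    abel

theorem Atiyah.restrict_surjective
    (hder : Function.Surjective (Derivation.compAlgebraMapL k A B B)) {ι : M →ₗ[A] N}
    (hι : IsBaseChange B ι) : Function.Surjective (Atiyah.restrict (k := k) B ι) := by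
  intro x
  obtain ⟨D, hD⟩ := hder x.1.1
  have hD_apply : ∀ a, D (algebraMap A B a) = x.1.1 a := Derivation.congr_fun hD
  let F := AtiyahAlong.tensorExtension x D hD_apply
  have hF : ∀ (b : B) (n : N), F (hι.equiv.symm (b • n)) = b • F (hι.equiv.symm n) + D b • n :=
    fun b n => by
      rw [map_smul, AtiyahAlong.tensorExtension_smul hι, LinearEquiv.apply_symm_apply]
  let P : N →ₗ[k] N :=
    { toFun := fun n => F (hι.equiv.symm n)
      map_add' := by simp
      map_smul' := fun c n => by
        rw [← algebraMap_smul B c n, hF, D.map_algebraMap, zero_smul, add_zero, algebraMap_smul,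
          RingHom.id_apply] }
  refine ⟨⟨(D, P), hF⟩, AtiyahAlong.ext hD_apply fun m => ?_⟩
  change F (hι.equiv.symm (ι m)) = x.1.2 m
  rw [hι.equiv_symm_apply, AtiyahAlong.tensorExtension_tmul]
  simp

theorem Atiyah.exists_isBaseChange [Module.FinitePresentation A Ω[A⁄k]] [Module.Flat A B]
    [Module.FinitePresentation A M]
    (hder : Function.Bijective (Derivation.compAlgebraMapL k A B B)) {ι : M →ₗ[A] N}
    (hι : IsBaseChange B ι) :
    ∃ (τ : Atiyah k A M →ₗ[A] Atiyah k B N) (δ : Derivation k A A →ₗ[A] Derivation k B B),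
      IsBaseChange B τ ∧ IsBaseChange B δ ∧
        ∀ x, δ (Atiyah.symbol k A M x) = Atiyah.symbol k B N (τ x) := by
  let e : Derivation k B B ≃ₗ[B] Derivation k A B := LinearEquiv.ofBijective _ hder
  let ε : Atiyah k B N ≃ₗ[B] AtiyahAlong k B ι := LinearEquiv.ofBijective (Atiyah.restrict B ι)
    ⟨Atiyah.restrict_injective hder.1 hι, Atiyah.restrict_surjective hder.2 hι⟩
  refine ⟨ε.symm.toLinearMap.restrictScalars A ∘ₗ AtiyahAlong.map k ι LinearMap.id,
    e.symm.toLinearMap.restrictScalars A ∘ₗ (Algebra.linearMap A B).compDer,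
    (AtiyahAlong.isBaseChange_map hι LinearMap.id).comp (.ofEquiv ε.symm),
    isBaseChange_compDer.comp (.ofEquiv e.symm), fun x => e.symm_apply_eq.2 ?_⟩
  exact (congrArg (fun y => y.1.1) (ε.apply_symm_apply (AtiyahAlong.map k ι LinearMap.id x))).symm

end AtiyahBaseChange

/-! ### The conditions `V(M) = Der_k(A)` and `lc(M) = 0` as vanishing of cokernels -/

section Criteria

variable {k : Type v} {A M : Type u} [Field k] [CommRing A] [Algebra k A]
  [AddCommGroup M] [Module A M] [Module k M] [IsScalarTower k A M]

theorem KLinearConnection.phi_eq_zero_iff (c : KLinearConnection k A M) :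
    c.phi = 0 ↔ ∀ (a : A) (D : V k A M), c.toLinearMap (a • D) = a • c.toLinearMap D := by
  constructor
  · intro h a D
    ext m
    have := LinearMap.congr_fun (LinearMap.congr_fun₂ (congrArg Subtype.val h) a D) m
    exact (sub_eq_zero.1 this).symm
  · intro h
    ext a D m
    rw [KLinearConnection.phi_apply, h, LinearMap.smul_apply, sub_self]
    rfl

/-- The connection `∇ - χ`, where `χ` has values in the `A`-linear endomorphisms of `M`. -/
def KLinearConnection.sub (c : KLinearConnection k A M) (χ : V k A M →ₗ[k] Module.End A M) :
    KLinearConnection k A M where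
  toLinearMap := c.toLinearMap - LinearMap.restrictScalarsₗ k A M M k ∘ₗ χ
  derivation_property D a m := by
    simp only [LinearMap.sub_apply, LinearMap.comp_apply, LinearMap.restrictScalarsₗ_apply,
      LinearMap.restrictScalars_apply, map_smul, c.derivation_property D a m, smul_sub]
    abel

theorem KLinearConnection.phi_sub (c : KLinearConnection k A M)
    (χ : V k A M →ₗ[k] Module.End A M) :
    (c.sub χ).phi = c.phi - d0 k A (V k A M) (Module.End A M) χ := by
  ext a D m
  change a • (c.toLinearMap D m - χ D m) - (c.toLinearMap (a • D) m - χ (a • D) m) =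
    (a • c.toLinearMap D m - c.toLinearMap (a • D) m) - (a • χ D m - χ (a • D) m)
  rw [smul_sub]
  abel

variable (k A M)

theorem lc_eq_zero_iff_exists_phi_eq_zero :
    lc k A M = 0 ↔ ∃ c : KLinearConnection k A M, c.phi = 0 := by
  constructor
  · rw [lc, hh1ToExt_eq_zero_iff, Submodule.Quotient.mk_eq_zero]
    rintro ⟨χ, hχ⟩
    exact ⟨_, (KLinearConnection.phi_sub _ χ).trans (sub_eq_zero.2 hχ.symm)⟩
  · rintro ⟨c, hc⟩
    rw [lc_eq k A M c, hc, hh1ToExt_eq_zero_iff, Submodule.Quotient.mk_zero]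

theorem lc_eq_zero_iff_exists_section :
    lc k A M = 0 ↔ ∃ s : V k A M →ₗ[A] Atiyah k A M, ∀ D, Atiyah.symbol k A M (s D) = D := by
  simp only [lc_eq_zero_iff_exists_phi_eq_zero, KLinearConnection.phi_eq_zero_iff]
  constructor
  · rintro ⟨c, hc⟩
    exact ⟨{ toFun := fun D => ⟨(D, c.toLinearMap D), c.derivation_property D⟩
             map_add' := fun D D' => Subtype.ext (Prod.ext rfl (map_add c.toLinearMap D D'))
             map_smul' := fun a D => Subtype.ext (Prod.ext rfl (hc a D)) }, fun _ => rfl⟩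
  · rintro ⟨s, hs⟩
    let P : V k A M →ₗ[A] M →ₗ[k] M := LinearMap.snd A _ _ ∘ₗ (Atiyah k A M).subtype ∘ₗ s
    refine ⟨⟨P.restrictScalars k, fun D a m => ?_⟩, P.map_smul⟩
    have hD : (s D).1.1 = D := hs D
    exact hD ▸ AtiyahAlong.leibniz (s D) a m

theorem Atiyah.range_symbol : LinearMap.range (Atiyah.symbol k A M) = V k A M := by
  ext D
  rw [mem_V_iff, kodairaSpencer_eq_zero_iff]
  exact ⟨fun ⟨x, hx⟩ => ⟨x.1.2, hx ▸ AtiyahAlong.leibniz x⟩, fun ⟨P, hP⟩ => ⟨⟨(D, P), hP⟩, rfl⟩⟩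

theorem V_eq_top_iff_subsingleton :
    V k A M = ⊤ ↔ Subsingleton (Derivation k A A ⧸ LinearMap.range (Atiyah.symbol k A M)) := by
  rw [← Atiyah.range_symbol, Submodule.Quotient.subsingleton_iff]

theorem lc_eq_zero_iff_subsingleton :
    lc k A M = 0 ↔ Subsingleton (SplittingCokernel (Atiyah.symbol k A M)) := by
  rw [lc_eq_zero_iff_exists_section, subsingleton_splittingCokernel_iff, ← Atiyah.range_symbol]
  exact exists_congr fun s => ⟨fun h => LinearMap.ext fun D => Subtype.ext (h D),
    fun h D => congrArg Subtype.val (LinearMap.congr_fun h D)⟩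

end Criteria

section Cokernels

open KaehlerDifferential

variable (k A M : Type*) [CommRing k] [CommRing A] [Algebra k A]
  [AddCommGroup M] [Module A M] [Module k M] [IsScalarTower k A M]

theorem Atiyah.exists_symbol_comp_eq_id [Module.Free A M] :
    ∃ s : Derivation k A A →ₗ[A] Atiyah k A M, Atiyah.symbol k A M ∘ₗ s = LinearMap.id := by
  let e := AtiyahAlong.equivOfBasis (k := k) (B := A) (Module.Free.chooseBasis A M) LinearMap.id
  exact ⟨e.symm.toLinearMap ∘ₗ LinearMap.inl A _ _, LinearMap.ext fun D =>
    congrArg Prod.fst (e.apply_symm_apply (D, 0))⟩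

theorem Atiyah.subsingleton_quotient_range_symbol_of_free [Module.Free A M] :
    Subsingleton (Derivation k A A ⧸ LinearMap.range (Atiyah.symbol k A M)) := by
  obtain ⟨s, hs⟩ := Atiyah.exists_symbol_comp_eq_id k A M
  rw [Submodule.Quotient.subsingleton_iff]
  exact LinearMap.range_eq_top.2 (LinearMap.surjective_of_comp_eq_id s _ hs)

theorem Atiyah.subsingleton_splittingCokernel_symbol_of_free [Module.Free A M] :
    Subsingleton (SplittingCokernel (Atiyah.symbol k A M)) := by
  obtain ⟨s, hs⟩ := Atiyah.exists_symbol_comp_eq_id k A M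
  exact (subsingleton_splittingCokernel_iff _).2 ⟨s ∘ₗ Submodule.subtype _, LinearMap.ext fun D =>
    Subtype.ext (LinearMap.congr_fun hs D)⟩

variable [IsNoetherianRing A] [Module.Finite A Ω[A⁄k]]

theorem finite_derivation : Module.Finite A (Derivation k A A) :=
  Module.Finite.equiv (linearMapEquivDerivation k A)

variable {k A M} {B N : Type*} [CommRing B] [Algebra k B] [Algebra A B] [IsScalarTower k A B]
  [Module.Flat A B] [AddCommGroup N] [Module B N] [Module k N] [IsScalarTower k B N]
  [Module A N] [IsScalarTower A B N] [IsScalarTower k A N] [Module.Finite A M]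

theorem Atiyah.exists_isBaseChange_quotient_range_symbol
    (hder : Function.Bijective (Derivation.compAlgebraMapL k A B B)) {ι : M →ₗ[A] N}
    (hι : IsBaseChange B ι) :
    ∃ γ : (Derivation k A A ⧸ LinearMap.range (Atiyah.symbol k A M)) →ₗ[A]
      (Derivation k B B ⧸ LinearMap.range (Atiyah.symbol k B N)), IsBaseChange B γ := by
  have := Module.finitePresentation_of_finite A Ω[A⁄k]
  have := Module.finitePresentation_of_finite A M
  obtain ⟨τ, δ, hτ, hδ, comm⟩ := Atiyah.exists_isBaseChange hder hι
  obtain ⟨γ, hγ, -⟩ := exists_isBaseChange_quotient_range hτ hδ comm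
  exact ⟨γ, hγ⟩

theorem Atiyah.exists_isBaseChange_splittingCokernel_symbol
    (hder : Function.Bijective (Derivation.compAlgebraMapL k A B B)) {ι : M →ₗ[A] N}
    (hι : IsBaseChange B ι) :
    ∃ γ : SplittingCokernel (Atiyah.symbol k A M) →ₗ[A] SplittingCokernel (Atiyah.symbol k B N),
      IsBaseChange B γ := by
  have := Module.finitePresentation_of_finite A Ω[A⁄k]
  have := Module.finitePresentation_of_finite A M
  have := finite_derivation k A
  have := Module.finitePresentation_of_finite A (LinearMap.range (Atiyah.symbol k A M))
  obtain ⟨τ, δ, hτ, hδ, comm⟩ := Atiyah.exists_isBaseChange hder hι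
  exact exists_isBaseChange_splittingCokernel hτ hδ comm

end Cokernels

/-! ### Unique extension of derivations -/

section FormallyEtale

open KaehlerDifferential

variable (k A B : Type*) [CommRing k] [CommRing A] [Algebra k A] [CommRing B] [Algebra k B]
  [Algebra A B] [IsScalarTower k A B]

theorem bijective_compAlgebraMapL_of_formallyEtale [Algebra.FormallyEtale A B] :
    Function.Bijective (Derivation.compAlgebraMapL k A B B) := by
  have hΩ := isBaseChange_of_formallyEtale k A B
  constructor
  · intro D D' h
    rw [← D.liftKaehlerDifferential_comp, ← D'.liftKaehlerDifferential_comp]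
    refine congrArg (fun f : Ω[B⁄k] →ₗ[B] B => f.compDer (KaehlerDifferential.D k B)) ?_
    refine hΩ.algHom_ext' _ _ (Derivation.liftKaehlerDifferential_unique _ _ ?_)
    ext a
    simpa using Derivation.congr_fun h a
  · intro D
    refine ⟨(hΩ.lift D.liftKaehlerDifferential).compDer (KaehlerDifferential.D k B), ?_⟩
    ext a
    simpa using hΩ.lift_eq D.liftKaehlerDifferential (KaehlerDifferential.D k A a)

theorem bijective_compAlgebraMapL_localization (S : Submonoid A) [IsLocalization S B] :
    Function.Bijective (Derivation.compAlgebraMapL k A B B) :=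
  have := Algebra.FormallyEtale.of_isLocalization (Rₘ := B) S
  bijective_compAlgebraMapL_of_formallyEtale k A B

end FormallyEtale

section AdicCompletion

variable {k A : Type*} [CommRing k] [CommRing A] [Algebra k A] (I : Ideal A)

theorem derivation_apply_mem_pow_smul_top {N : Type*} [AddCommGroup N] [Module A N] [Module k N]
    (D : Derivation k A N) {n : ℕ} {a : A} (ha : a ∈ I ^ (n + 1)) :
    D a ∈ (I ^ n • ⊤ : Submodule A N) := by
  induction n generalizing a with
  | zero => simp
  | succ n ih =>
    rw [pow_succ'] at ha
    induction ha using Submodule.mul_induction_on' with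
    | mem_mul_mem x hx y hy =>
      rw [Derivation.leibniz]
      refine add_mem ?_ (Submodule.smul_mem_smul hy trivial)
      rw [pow_succ', ← smul_eq_mul, smul_assoc]
      exact Submodule.smul_mem_smul hx (ih hy)
    | add x _ y _ hx hy => rw [map_add]; exact add_mem hx hy

theorem exists_sub_algebraMap_mem_pow_smul_top (hI : I.FG) (x : AdicCompletion I A) (n : ℕ) :
    ∃ a : A, x - algebraMap A (AdicCompletion I A) a ∈
      (I ^ n • ⊤ : Submodule A (AdicCompletion I A)) := by
  obtain ⟨a, ha⟩ := Submodule.mkQ_surjective _ (x.val n)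
  refine ⟨a, ?_⟩
  rw [AdicCompletion.pow_smul_top_eq_ker_eval hI, LinearMap.mem_ker, map_sub, sub_eq_zero]
  exact ha.symm

theorem injective_compAlgebraMapL_adicCompletion (hI : I.FG) {N : Type*} [AddCommGroup N]
    [Module A N] [Module (AdicCompletion I A) N] [Module k N]
    [IsScalarTower A (AdicCompletion I A) N] [IsScalarTower k (AdicCompletion I A) N]
    [IsHausdorff I N] :
    Function.Injective (Derivation.compAlgebraMapL k A (AdicCompletion I A) N) := by
  rw [injective_iff_map_eq_zero]
  intro D hD
  have hD (a : A) : D (algebraMap A (AdicCompletion I A) a) = 0 := Derivation.congr_fun hD a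
  let L : AdicCompletion I A →ₗ[A] N :=
    { toFun := D
      map_add' := map_add D
      map_smul' := fun a x => by simp [Algebra.smul_def, hD] }
  ext x
  refine IsHausdorff.haus ‹_› (D x) fun n => ?_
  obtain ⟨a, ha⟩ := exists_sub_algebraMap_mem_pow_smul_top I hI x n
  have hx := Submodule.smul_top_le_comap_smul_top (I ^ n) L ha
  rw [SModEq.zero]
  simpa [L, hD] using hx

variable {I} (D : Derivation k A (AdicCompletion I A))

/-- The additive map `A / Iⁿ⁺¹ → A / Iⁿ` induced by a derivation `D` of `A` into its `I`-adic
completion. -/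
def derivationModPow (n : ℕ) : A ⧸ (I ^ (n + 1) • ⊤ : Ideal A) →+ A ⧸ (I ^ n • ⊤ : Ideal A) :=
  QuotientAddGroup.lift _
    ((AdicCompletion.eval I A n).toAddMonoidHom.comp D.toLinearMap.toAddMonoidHom) fun _ ha =>
    AdicCompletion.pow_smul_top_le_ker_eval I n <|
      derivation_apply_mem_pow_smul_top I D <| by rwa [smul_eq_mul, Ideal.mul_top] at ha

theorem derivationModPow_mk (n : ℕ) (a : A) :
    derivationModPow D n (Submodule.Quotient.mk a) = (D a).val n :=
  rfl

theorem transitionMap_derivationModPow {m n : ℕ} (hmn : m ≤ n)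
    (x : A ⧸ (I ^ (n + 1) • ⊤ : Ideal A)) :
    AdicCompletion.transitionMap I A hmn (derivationModPow D n x) =
      derivationModPow D m (AdicCompletion.transitionMap I A (Nat.succ_le_succ hmn) x) := by
  obtain ⟨a, rfl⟩ := Submodule.Quotient.mk_surjective _ x
  exact (D a).property hmn

theorem derivationModPow_smul (n : ℕ) (c : k) (x : A ⧸ (I ^ (n + 1) • ⊤ : Ideal A)) :
    derivationModPow D n (c • x) = c • derivationModPow D n x := by
  obtain ⟨a, rfl⟩ := Submodule.Quotient.mk_surjective _ x
  rw [← Submodule.Quotient.mk_smul, derivationModPow_mk, derivationModPow_mk, D.map_smul,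
    AdicCompletion.val_smul_apply]

theorem derivationModPow_mul (n : ℕ) (x y : A ⧸ (I ^ (n + 1) • ⊤ : Ideal A)) :
    derivationModPow D n (x * y) =
      AdicCompletion.transitionMap I A n.le_succ x * derivationModPow D n y +
        AdicCompletion.transitionMap I A n.le_succ y * derivationModPow D n x := by
  obtain ⟨a, rfl⟩ := Submodule.Quotient.mk_surjective _ x
  obtain ⟨b, rfl⟩ := Submodule.Quotient.mk_surjective _ y
  exact congrArg (AdicCompletion.eval I A n) (D.leibniz a b)

/-- The extension of a derivation of `A` into its `I`-adic completion to a derivation of the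
completion. -/
def completionDerivation : Derivation k (AdicCompletion I A) (AdicCompletion I A) :=
  Derivation.mk'
    { toFun x := ⟨fun n => derivationModPow D n (x.val (n + 1)), fun hmn => by
        rw [transitionMap_derivationModPow, x.property]⟩
      map_add' x y := AdicCompletion.ext fun n => map_add (derivationModPow D n) _ _
      map_smul' c x := AdicCompletion.ext fun n => derivationModPow_smul D n c _ }
    fun x y => AdicCompletion.ext fun n => by
      refine (derivationModPow_mul D n _ _).trans ?_
      rw [x.property, y.property]
      rfl

theorem bijective_compAlgebraMapL_adicCompletion (hI : I.FG) :
    Function.Bijective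
      (Derivation.compAlgebraMapL k A (AdicCompletion I A) (AdicCompletion I A)) :=
  ⟨injective_compAlgebraMapL_adicCompletion I hI, fun D => ⟨completionDerivation D, rfl⟩⟩

end AdicCompletion

/-! ### Localization and completion at a point -/

section Points

variable {A : Type u} [CommRing A]

theorem comap_closedPoint_localization (p : PrimeSpectrum A) :
    PrimeSpectrum.comap (algebraMap A (Localization.AtPrime p.asIdeal))
      (IsLocalRing.closedPoint (Localization.AtPrime p.asIdeal)) = p :=
  PrimeSpectrum.ext (IsLocalization.AtPrime.under_maximalIdeal _ p.asIdeal)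

theorem notMem_support_of_isBaseChange_localization {p : PrimeSpectrum A} {M N : Type*}
    [AddCommGroup M] [Module A M] [Module.Finite A M] [AddCommGroup N] [Module A N]
    [Module (Localization.AtPrime p.asIdeal) N]
    [IsScalarTower A (Localization.AtPrime p.asIdeal) N] [Subsingleton N] {f : M →ₗ[A] N}
    (hf : IsBaseChange (Localization.AtPrime p.asIdeal) f) : p ∉ Module.support A M := by
  simpa only [comap_closedPoint_localization] using
    comap_notMem_support_of_isBaseChange hf (IsLocalRing.closedPoint _)

theorem mem_range_comap_adicCompletion (p : PrimeSpectrum A) :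
    p ∈ Set.range (PrimeSpectrum.comap (algebraMap A (AdicCompletion p.asIdeal A))) := by
  refine ⟨PrimeSpectrum.comap (AdicCompletion.evalOneₐ p.asIdeal).toRingHom ⊥, ?_⟩
  rw [← PrimeSpectrum.comap_comp_apply, AdicCompletion.evalOneₐ_comp_algebraMap_eq_mk]
  exact PrimeSpectrum.ext (Ideal.mk_ker)

theorem isBaseChange_adicCompletion_of [IsNoetherianRing A] (I : Ideal A) (M : Type u)
    [AddCommGroup M] [Module A M] [Module.Finite A M] :
    IsBaseChange (AdicCompletion I A) (AdicCompletion.of I M) :=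
  IsBaseChange.of_equiv (AdicCompletion.ofTensorProductEquivOfFiniteNoetherian I M) fun x => by
    simp

end Points

section Support

open KaehlerDifferential

variable {k : Type*} {A M : Type u} [CommRing k] [CommRing A] [Algebra k A] [IsNoetherianRing A]
  [Module.Finite A Ω[A⁄k]] [AddCommGroup M] [Module A M] [Module k M] [IsScalarTower k A M]
  [Module.Finite A M] {p : PrimeSpectrum A}

theorem Atiyah.support_quotient_range_symbol_subset (hM : LocallyFreeAwayFrom p.asIdeal M) :
    Module.support A (Derivation k A A ⧸ LinearMap.range (Atiyah.symbol k A M)) ⊆ {p} := by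
  intro q hq
  by_contra hqp
  have := hM q fun h => hqp (PrimeSpectrum.ext h)
  have := finite_derivation k A
  obtain ⟨γ, hγ⟩ := Atiyah.exists_isBaseChange_quotient_range_symbol
    (bijective_compAlgebraMapL_localization k A (Localization.AtPrime q.asIdeal)
      q.asIdeal.primeCompl)
    (IsLocalizedModule.isBaseChange q.asIdeal.primeCompl _
      (LocalizedModule.mkLinearMap q.asIdeal.primeCompl M))
  have := Atiyah.subsingleton_quotient_range_symbol_of_free k (Localization.AtPrime q.asIdeal)
    (LocalizedModule q.asIdeal.primeCompl M)
  exact notMem_support_of_isBaseChange_localization hγ hq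

theorem Atiyah.support_splittingCokernel_symbol_subset (hM : LocallyFreeAwayFrom p.asIdeal M) :
    Module.support A (SplittingCokernel (Atiyah.symbol k A M)) ⊆ {p} := by
  intro q hq
  by_contra hqp
  have := hM q fun h => hqp (PrimeSpectrum.ext h)
  have := finite_derivation k A
  obtain ⟨γ, hγ⟩ := Atiyah.exists_isBaseChange_splittingCokernel_symbol
    (bijective_compAlgebraMapL_localization k A (Localization.AtPrime q.asIdeal)
      q.asIdeal.primeCompl)
    (IsLocalizedModule.isBaseChange q.asIdeal.primeCompl _
      (LocalizedModule.mkLinearMap q.asIdeal.primeCompl M))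
  have := Atiyah.subsingleton_splittingCokernel_symbol_of_free k (Localization.AtPrime q.asIdeal)
    (LocalizedModule q.asIdeal.primeCompl M)
  exact notMem_support_of_isBaseChange_localization hγ hq

end Support

section Main

open KaehlerDifferential

variable {k : Type v} {A M B N : Type u} [Field k] [CommRing A] [Algebra k A] [IsNoetherianRing A]
  [Module.Finite A Ω[A⁄k]] [AddCommGroup M] [Module A M] [Module k M] [IsScalarTower k A M]
  [Module.Finite A M] [CommRing B] [Algebra k B] [Algebra A B] [IsScalarTower k A B]
  [Module.Flat A B] [AddCommGroup N] [Module B N] [Module k N] [IsScalarTower k B N]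
  [Module A N] [IsScalarTower A B N] [IsScalarTower k A N] {p : PrimeSpectrum A} {ι : M →ₗ[A] N}

theorem V_eq_top_iff_of_isBaseChange (hM : LocallyFreeAwayFrom p.asIdeal M)
    (hp : p ∈ Set.range (PrimeSpectrum.comap (algebraMap A B)))
    (hder : Function.Bijective (Derivation.compAlgebraMapL k A B B)) (hι : IsBaseChange B ι) :
    V k A M = ⊤ ↔ V k B N = ⊤ := by
  have := finite_derivation k A
  obtain ⟨γ, hγ⟩ := Atiyah.exists_isBaseChange_quotient_range_symbol hder hι
  rw [V_eq_top_iff_subsingleton, V_eq_top_iff_subsingleton]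
  exact subsingleton_iff_of_support_subset (Atiyah.support_quotient_range_symbol_subset hM) hp hγ

theorem lc_eq_zero_iff_of_isBaseChange (hM : LocallyFreeAwayFrom p.asIdeal M)
    (hp : p ∈ Set.range (PrimeSpectrum.comap (algebraMap A B)))
    (hder : Function.Bijective (Derivation.compAlgebraMapL k A B B)) (hι : IsBaseChange B ι) :
    lc k A M = 0 ↔ lc k B N = 0 := by
  have := finite_derivation k A
  obtain ⟨γ, hγ⟩ := Atiyah.exists_isBaseChange_splittingCokernel_symbol hder hι
  rw [lc_eq_zero_iff_subsingleton, lc_eq_zero_iff_subsingleton]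
  exact subsingleton_iff_of_support_subset (Atiyah.support_splittingCokernel_symbol_subset hM) hp hγ

end Main

end

end KodairaSpencer

open KaehlerDifferential in
theorem mainTheorem7_general
    (k : Type v) [Field k]
    (A : Type u) [CommRing A] [Algebra k A] [IsNoetherianRing A] [Module.Finite A Ω[A⁄k]]
    (m : Ideal A) [hm : m.IsPrime]
    (M : Type u) [AddCommGroup M] [Module A M] [Module k M] [IsScalarTower k A M]
    [Module.Finite A M]
    (hM : KodairaSpencer.LocallyFreeAwayFrom m M) :
    ((KodairaSpencer.V k A M = ⊤ ↔
        KodairaSpencer.V k (Localization.AtPrime m) (LocalizedModule m.primeCompl M) = ⊤) ∧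
      (KodairaSpencer.V k (Localization.AtPrime m) (LocalizedModule m.primeCompl M) = ⊤ ↔
        KodairaSpencer.V k (AdicCompletion m A) (AdicCompletion m M) = ⊤)) ∧
    ((KodairaSpencer.lc k A M = 0 ↔
        KodairaSpencer.lc k (Localization.AtPrime m) (LocalizedModule m.primeCompl M) = 0) ∧
      (KodairaSpencer.lc k (Localization.AtPrime m) (LocalizedModule m.primeCompl M) = 0 ↔
        KodairaSpencer.lc k (AdicCompletion m A) (AdicCompletion m M) = 0)) := by
  have memLoc := Set.mem_range.2 ⟨_, KodairaSpencer.comap_closedPoint_localization ⟨m, hm⟩⟩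
  have memCompl := KodairaSpencer.mem_range_comap_adicCompletion ⟨m, hm⟩
  have derLoc := KodairaSpencer.bijective_compAlgebraMapL_localization k A
    (Localization.AtPrime m) m.primeCompl
  have derCompl := KodairaSpencer.bijective_compAlgebraMapL_adicCompletion (k := k)
    m.fg_of_isNoetherianRing
  have baseLoc : IsBaseChange (Localization.AtPrime m) _ :=
    IsLocalizedModule.isBaseChange m.primeCompl _ (LocalizedModule.mkLinearMap m.primeCompl M)
  have baseCompl := KodairaSpencer.isBaseChange_adicCompletion_of m M
  have V_loc := KodairaSpencer.V_eq_top_iff_of_isBaseChange hM memLoc derLoc baseLoc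
  have V_compl := KodairaSpencer.V_eq_top_iff_of_isBaseChange hM memCompl derCompl baseCompl
  have lc_loc := KodairaSpencer.lc_eq_zero_iff_of_isBaseChange hM memLoc derLoc baseLoc
  have lc_compl := KodairaSpencer.lc_eq_zero_iff_of_isBaseChange hM memCompl derCompl baseCompl
  exact ⟨⟨V_loc, V_loc.symm.trans V_compl⟩, lc_loc, lc_loc.symm.trans lc_compl⟩

theorem mainTheorem7
    (k : Type v) [Field k] [IsAlgClosed k] [CharZero k]
    (A : Type u) [CommRing A] [Algebra k A] [Algebra.FiniteType k A]
    (m : Ideal A) [m.IsMaximal]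
    (M : Type u) [AddCommGroup M] [Module A M] [Module k M] [IsScalarTower k A M]
    [Module.Finite A M]
    (hM : KodairaSpencer.LocallyFreeAwayFrom m M) :
    ((KodairaSpencer.V k A M = ⊤ ↔
        KodairaSpencer.V k (Localization.AtPrime m) (LocalizedModule m.primeCompl M) = ⊤) ∧
      (KodairaSpencer.V k (Localization.AtPrime m) (LocalizedModule m.primeCompl M) = ⊤ ↔
        KodairaSpencer.V k (AdicCompletion m A) (AdicCompletion m M) = ⊤)) ∧
    ((KodairaSpencer.lc k A M = 0 ↔
        KodairaSpencer.lc k (Localization.AtPrime m) (LocalizedModule m.primeCompl M) = 0) ∧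
      (KodairaSpencer.lc k (Localization.AtPrime m) (LocalizedModule m.primeCompl M) = 0 ↔
        KodairaSpencer.lc k (AdicCompletion m A) (AdicCompletion m M) = 0)) := by
  have := Algebra.FiniteType.isNoetherianRing k A
  exact mainTheorem7_general k A m M hM
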